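/- Let $R$ be a commutative ring and work in the polynomial ring $R[x_0,x_1,x_2,\dots]$, with $\partial_j=\partial/\partial x_j$. For $k\ge 1$ put $$\mathcal D_k=\sum_{j=0}^{k-1}x_{j+1}\,\partial_j ,\qquad \Delta_k=\mathcal D_k\mathcal D_{k-1}\cdots\mathcal D_1 ,$$ and let $\Delta_0$ be the identity. Let $\mathcal D=\sum_{j\ge 0}x_{j+1}\,\partial_j$ (the $R$-derivation with $\mathcal D x_j=x_{j+1}$ for all $j\ge 0$), and let $S$ be the $R$-algebra endomorphism with $S x_j=x_{j+1}$ for all $j\ge0$. A rooted tree $T$ on $[n]=\{1,\dots,n\}$ is a tree on the vertex set $[n]$ together with a distinguished vertex, the root; its edges are oriented towards the root, and $\mathrm d_T(i)$ denotes the in-degree of the vertex $i$. For an unrooted tree $\mathfrak a$ on $[n]$, $d_{\mathfrak a}(i)$ denotes the degree of the vertex $i$. Define $$\mathcal A_n=\sum_{T}\ \prod_{i=1}^n x_{\mathrm d_T(i)},\qquad \mathfrak A_n=\sum_{\mathfrak a}\ \prod_{i=1}^n x_{d_{\mathfrak a}(i)},$$ where $T$ runs over all rooted trees on $[n]$ and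 $\mathfrak a$ over all unrooted trees on $[n]$. Then $$\mathcal A_n=\Delta_{n-1}\,x_0^n\qquad\text{for all } n\ge 1,$$ and $$\mathfrak A_n=S\bigl(\Delta_{n-2}\,x_0^n\bigr)=\mathcal D^{\,n-2}x_1^n\qquad\text{for all } n\ge 2$$ (the last identity is what is meant by $\mathfrak A_n=\Delta_{n-2}x_1^n$: the operator $\Delta_{n-2}$ is applied with $x_1,x_2,\dots$ in the roles of $x_0,x_1,\dots$). -/

import Mathlib

open MvPolynomial

noncomputable section

/-- The operator `𝒟_n = ∑_{j=0}^{n-1} x_{j+1} ∂_j`, acting on polynomials in `x_0, x_1, x_2, …`. -/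
def dartOp (R : Type*) [CommRing R] (n : ℕ) : MvPolynomial ℕ R →ₗ[R] MvPolynomial ℕ R :=
  ∑ j ∈ Finset.range n,
    (LinearMap.mulLeft R (X (j + 1) : MvPolynomial ℕ R)).comp (pderiv j).toLinearMap

/-- The operator `Δ_n = 𝒟_n 𝒟_{n-1} ⋯ 𝒟_1`; `Δ_0` is the identity. -/
def deltaOp (R : Type*) [CommRing R] : ℕ → (MvPolynomial ℕ R →ₗ[R] MvPolynomial ℕ R)
  | 0 => LinearMap.id
  | n + 1 => (dartOp R (n + 1)).comp (deltaOp R n)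

/-- The untruncated operator `𝒟 = ∑_{j ≥ 0} x_{j+1} ∂_j`, i.e. the `R`-derivation with
`x_j ↦ x_{j+1}` for every `j`. -/
def fullDartOp (R : Type*) [CommRing R] :
    Derivation R (MvPolynomial ℕ R) (MvPolynomial ℕ R) :=
  mkDerivation R (fun j : ℕ => (X (j + 1) : MvPolynomial ℕ R))

/-- The substitution `S : x_j ↦ x_{j+1}` for every `j`. -/
def shiftVars (R : Type*) [CommRing R] : MvPolynomial ℕ R →ₐ[R] MvPolynomial ℕ R :=
  rename Nat.succ

/-- In-degree of the vertex `v` in the tree `G` rooted at `r`, all edges being oriented towards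
the root: the number of edges `w → v`, i.e. of neighbours `w` of `v` that are farther from the
root than `v`. -/
def rootedInDegree {V : Type*} (G : SimpleGraph V) (r v : V) : ℕ :=
  {w : V | G.Adj w v ∧ G.dist v r < G.dist w r}.ncard

open Classical in
/-- `∑_T ∏_v x_{d_T(v)}` over the rooted trees `T = (G, r)` on an `n`-element vertex set (a tree
`G` together with a vertex `r`), `d_T(v)` being the in-degree. -/
def rootedTreePoly (R : Type*) [CommRing R] (n : ℕ) : MvPolynomial ℕ R :=
  ∑ T ∈ Finset.univ.filter (fun T : SimpleGraph (Fin n) × Fin n => T.1.IsTree),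
    ∏ v : Fin n, X (rootedInDegree T.1 T.2 v)

open Classical in
/-- `∑_G ∏_v x_{deg_G(v)}` over the (unrooted) trees `G` on an `n`-element vertex set. -/
def treePoly (R : Type*) [CommRing R] (n : ℕ) : MvPolynomial ℕ R :=
  ∑ G ∈ Finset.univ.filter (fun G : SimpleGraph (Fin n) => G.IsTree),
    ∏ v : Fin n, X (G.degree v)

end

/-! By the Leibniz rule, applying `𝒟` to a monomial `∏ x_{a v}` raises one index `a v` by one. Hence
`𝒟^k` of it is the sum over words `f` of length `k` in the letters `v` of `∏ x_{a v + count of v in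
f}` (`fullDartOp_iterate_prod_X`).

The trees on `n` vertices with degree function `d` are as many as the words of length `n - 2` using
each `w` exactly `d w - 1` times. This is Prüfer's count, proved without his bijection: for any `v`
with `d v = 1`, deleting the leaf `v` and deleting the first letter give the same recursion
(`card_connected_degree_eq_card_words`). Taking `a = 1` settles unrooted trees.

For a root `r`, in-degree is degree minus one away from `r` and degree at `r`, i.e. the letter count
of the word with `r` prepended. So rooted trees correspond to words of length `n - 1`, with `a = 0`.
-/

/-- The number of times the word `f` uses the letter `v`. -/
def letterCount {V : Type*} [DecidableEq V] {m : ℕ} (f : Fin m → V) (v : V) : ℕ :=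
  ∑ i, if f i = v then 1 else 0

lemma letterCount_cons {V : Type*} [DecidableEq V] {m : ℕ} (u : V) (f : Fin m → V) (v : V) :
    letterCount (Fin.cons u f : Fin (m + 1) → V) v =
      (if u = v then 1 else 0) + letterCount f v := by
  simp only [letterCount, Fin.sum_univ_succ, Fin.cons_zero, Fin.cons_succ]

lemma sum_letterCount {V : Type*} [Fintype V] [DecidableEq V] {m : ℕ} (f : Fin m → V) :
    ∑ v, letterCount f v = m := by
  simp only [letterCount]
  rw [Finset.sum_comm]
  simp

/-! ### Leaf removal in connected graphs -/

namespace SimpleGraph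

lemma degree_eq_sum_ite {V : Type*} [Fintype V] (G : SimpleGraph V) [DecidableRel G.Adj] (v : V) :
    G.degree v = ∑ w, if G.Adj v w then 1 else 0 := by
  rw [← card_neighborFinset_eq_degree, neighborFinset_eq_filter, Finset.card_filter]

open Classical in
lemma degree_eq_add_degree_comap {V : Type*} [Fintype V] (G : SimpleGraph V) (v : V)
    (H : SimpleGraph {w // w ≠ v}) (hH : G.comap Subtype.val = H) (w : {w // w ≠ v}) :
    G.degree w = H.degree w + (if G.Adj v w then 1 else 0) := by
  subst hH
  rw [degree_eq_sum_ite, degree_eq_sum_ite, Fintype.sum_eq_add_sum_subtype_ne _ v, add_comm, adj_comm]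
  simp only [comap_adj]

/-- The graph obtained from `H`, a graph on the vertices other than `v`, by joining `v` to `u`. -/
def attachLeaf {V : Type*} (v : V) (u : {w // w ≠ v}) (H : SimpleGraph {w // w ≠ v}) :
    SimpleGraph V where
  Adj a b := (∃ ha hb, H.Adj ⟨a, ha⟩ ⟨b, hb⟩) ∨ (a = v ∧ b = u) ∨ (a = u ∧ b = v)
  symm := ⟨by
    rintro a b (⟨ha, hb, h⟩ | h | h)
    · exact Or.inl ⟨hb, ha, h.symm⟩
    · exact Or.inr (Or.inr h.symm)
    · exact Or.inr (Or.inl h.symm)⟩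
  loopless := ⟨by
    rintro a (⟨ha, hb, h⟩ | ⟨h, h'⟩ | ⟨h', h⟩)
    · exact H.irrefl h
    · exact u.2 (h'.symm.trans h)
    · exact u.2 (h'.symm.trans h)⟩

lemma attachLeaf_adj_left {V : Type*} (v : V) (u : {w // w ≠ v}) (H : SimpleGraph {w // w ≠ v})
    (b : V) : (attachLeaf v u H).Adj v b ↔ b = u := by
  have := u.2
  change (∃ ha hb, H.Adj ⟨v, ha⟩ ⟨b, hb⟩) ∨ (v = v ∧ b = u) ∨ (v = u ∧ b = v) ↔ _
  constructor
  · rintro (⟨ha, -⟩ | h | h)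
    · exact absurd rfl ha
    · exact h.2
    · exact absurd h.1.symm this
  · intro h
    exact Or.inr (Or.inl ⟨rfl, h⟩)

lemma comap_attachLeaf {V : Type*} (v : V) (u : {w // w ≠ v}) (H : SimpleGraph {w // w ≠ v}) :
    (attachLeaf v u H).comap Subtype.val = H := by
  ext a b
  simp only [attachLeaf, comap_adj]
  constructor
  · rintro (⟨ha, hb, h⟩ | h | h)
    · exact h
    · exact absurd h.1 a.2
    · exact absurd h.2 b.2
  · exact fun h => Or.inl ⟨a.2, b.2, h⟩

lemma attachLeaf_comap {V : Type*} (G : SimpleGraph V) (v : V) (u : {w // w ≠ v})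
    (h : ∀ b, G.Adj v b ↔ b = u) : attachLeaf v u (G.comap Subtype.val) = G := by
  have huniq (a b : V) (hab : G.Adj a b) (ha : a = v) : b = u := (h b).1 (ha ▸ hab)
  have hvu : G.Adj v u := (h u).2 rfl
  ext a b
  simp only [attachLeaf, comap_adj]
  constructor
  · rintro (⟨ha, hb, h⟩ | ⟨rfl, rfl⟩ | ⟨rfl, rfl⟩)
    · exact h
    · exact hvu
    · exact hvu.symm
  · intro hab
    by_cases ha : a = v
    · exact Or.inr (Or.inl ⟨ha, huniq a b hab ha⟩)
    by_cases hb : b = v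
    · exact Or.inr (Or.inr ⟨huniq b a hab.symm hb, hb⟩)
    · exact Or.inl ⟨ha, hb, hab⟩

lemma Connected.attachLeaf {V : Type*} {v : V} {u : {w // w ≠ v}}
    {H : SimpleGraph {w // w ≠ v}} (hH : H.Connected) : (attachLeaf v u H).Connected := by
  rw [connected_iff_exists_forall_reachable]
  refine ⟨u, fun w => ?_⟩
  by_cases hw : w = v
  · subst hw
    exact ((attachLeaf_adj_left w u H u).2 rfl).symm.reachable
  · let φ : H →g SimpleGraph.attachLeaf v u H :=
      ⟨Subtype.val, fun {a b} h => Or.inl ⟨a.2, b.2, h⟩⟩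
    exact (hH u ⟨w, hw⟩).map φ

open Classical in
lemma degree_attachLeaf_self {V : Type*} [Fintype V] (v : V) (u : {w // w ≠ v})
    (H : SimpleGraph {w // w ≠ v}) : (attachLeaf v u H).degree v = 1 := by
  simp [degree_eq_sum_ite, attachLeaf_adj_left]

open Classical in
/-- Removing the leaf `v` from the connected graphs with degree function `d`, where `d v = 1`. -/
lemma card_connected_degree_eq_sum {V : Type*} [Fintype V] (d : V → ℕ) (v : V) (hv : d v = 1) :
    (Finset.univ.filter fun G : SimpleGraph V => G.Connected ∧ ∀ w, G.degree w = d w).card =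
      ∑ u : {w // w ≠ v}, (Finset.univ.filter fun H : SimpleGraph {w // w ≠ v} =>
        H.Connected ∧ ∀ w, H.degree w + (if w = u then 1 else 0) = d w).card := by
  rw [← Finset.card_sigma]
  symm
  -- The index `u` is the unique neighbour of the leaf `v`.
  refine Finset.card_bij (fun p _ => attachLeaf v p.1 p.2) ?_ ?_ ?_
  · rintro ⟨u, H⟩ hp
    simp only [Finset.mem_sigma, Finset.mem_univ, true_and, Finset.mem_filter] at hp ⊢
    refine ⟨hp.1.attachLeaf, fun w => ?_⟩
    by_cases hw : w = v
    · rw [hw, hv, degree_attachLeaf_self]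
    · have h1 := degree_eq_add_degree_comap (attachLeaf v u H) v H
        (comap_attachLeaf v u H) ⟨w, hw⟩
      have h2 := hp.2 ⟨w, hw⟩
      rw [← h2, h1]
      simp only [attachLeaf_adj_left, Subtype.ext_iff]
  · rintro ⟨u, H⟩ _ ⟨u', H'⟩ _ h
    have hH : H = H' := by
      rw [← comap_attachLeaf v u H, ← comap_attachLeaf v u' H', h]
    have hu : u = u' := by
      have h1 := (attachLeaf_adj_left v u H u).2 rfl
      dsimp only at h
      rw [h, attachLeaf_adj_left] at h1
      exact Subtype.ext h1
    rw [hH, hu]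
  · intro G hG
    simp only [Finset.mem_univ, true_and, Finset.mem_filter] at hG
    obtain ⟨u, hu, huniq⟩ := degree_eq_one_iff_existsUnique_adj.1 ((hG.2 v).trans hv)
    have hu' : ∀ b, G.Adj v b ↔ b = u := fun b => ⟨huniq b, fun h => h ▸ hu⟩
    refine ⟨⟨⟨u, hu.ne'⟩, G.comap Subtype.val⟩, ?_, attachLeaf_comap G v ⟨u, hu.ne'⟩ hu'⟩
    simp only [Finset.mem_sigma, Finset.mem_univ, true_and, Finset.mem_filter]
    constructor
    · have := hG.1.induce_compl_singleton_of_degree_eq_one ((hG.2 v).trans hv)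
      exact this
    · intro w
      rw [← hG.2 w, degree_eq_add_degree_comap G v _ rfl w]
      simp only [hu', Subtype.ext_iff]

end SimpleGraph

/-- Words in which the letter `v` does not occur, according to their first letter. -/
lemma card_letterCount_eq_sum {V : Type*} [Fintype V] [DecidableEq V] (m : ℕ) (d : V → ℕ) (v : V)
    (hv : d v = 1) :
    (Finset.univ.filter fun f : Fin (m + 1) → V => ∀ w, 1 + letterCount f w = d w).card =
      ∑ u : {w // w ≠ v}, (Finset.univ.filter fun f : Fin m → {w // w ≠ v} =>
        ∀ w, 1 + letterCount f w + (if w = u then 1 else 0) = d w).card := by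
  have hval (f : Fin m → {w // w ≠ v}) (w : {w // w ≠ v}) :
      letterCount (fun i => (f i : V)) w = letterCount f w := by
    simp only [letterCount, Subtype.ext_iff]
  rw [← Finset.card_sigma]
  symm
  refine Finset.card_bij (fun p _ => Fin.cons p.1 fun i => (p.2 i : V)) ?_ ?_ ?_
  · rintro ⟨u, f⟩ hp
    simp only [Finset.mem_sigma, Finset.mem_univ, true_and, Finset.mem_filter] at hp ⊢
    intro w
    rw [letterCount_cons]
    by_cases hw : w = v
    · have : letterCount (fun i => (f i : V)) v = 0 := by
        simp [letterCount, (f _).2]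
      rw [hw, this, if_neg u.2, hv]
    · have := hp ⟨w, hw⟩
      rw [← hval] at this
      rw [← this]
      simp only [Subtype.ext_iff, eq_comm (a := w)]
      ring
  · rintro ⟨u, f⟩ _ ⟨u', f'⟩ _ h
    obtain ⟨h1, h2⟩ := Fin.cons_inj.1 h
    dsimp only at h1 h2
    rw [Subtype.ext h1, funext fun i => Subtype.ext (congrFun h2 i)]
  · intro f hf
    simp only [Finset.mem_univ, true_and, Finset.mem_filter] at hf
    have hne : ∀ i, f i ≠ v := by
      have h0 : letterCount f v = 0 := by have := hf v; omega
      intro i hi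
      have := (Finset.sum_eq_zero_iff.1 h0) i (Finset.mem_univ i)
      simp [hi] at this
    have hcons : (Fin.cons (f 0) fun i => f i.succ : Fin (m + 1) → V) = f := Fin.cons_self_tail f
    refine ⟨⟨⟨f 0, hne 0⟩, fun i => ⟨f i.succ, hne _⟩⟩, ?_, hcons⟩
    simp only [Finset.mem_sigma, Finset.mem_univ, true_and, Finset.mem_filter]
    intro w
    rw [← hf w, ← hval]
    conv_rhs => rw [← hcons, letterCount_cons]
    simp only [Subtype.ext_iff, eq_comm (a := (w : V))]
    ring

/-! ### Counting trees by degree function -/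

namespace SimpleGraph

open Classical in
lemma filter_connected_degree_eq_one {V : Type*} [Fintype V] (hV : Fintype.card V = 2) :
    (Finset.univ.filter fun G : SimpleGraph V => G.Connected ∧ ∀ w, G.degree w = 1) = {⊤} := by
  have : Nontrivial V := Fintype.one_lt_card_iff_nontrivial.1 (by omega)
  ext G
  simp only [Finset.mem_filter, Finset.mem_univ, true_and, Finset.mem_singleton]
  constructor
  · rintro ⟨-, hG⟩
    rw [eq_top_iff]
    intro a b hab
    obtain ⟨c, hc, -⟩ := degree_eq_one_iff_existsUnique_adj.1 (hG a)
    obtain rfl : c = b := by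
      by_contra hcb
      have h3 : ({a, b, c} : Finset V).card = 3 :=
        Finset.card_eq_three.2 ⟨a, b, c, hab, hc.ne, Ne.symm hcb, rfl⟩
      have := Finset.card_le_univ ({a, b, c} : Finset V)
      omega
    exact hc
  · rintro rfl
    refine ⟨connected_top, fun w => ?_⟩
    rw [degree_eq_sum_ite]
    have h : (Finset.univ.filter fun b => w ≠ b).card = 1 := by
      rw [Finset.filter_ne, Finset.card_erase_of_mem (Finset.mem_univ w), Finset.card_univ, hV]
    simpa [Finset.card_filter] using h

open Classical in
/-- The number of connected graphs with degree function `d`, of total degree twice the number of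
edges of a tree, is the number of words in which each letter `w` occurs `d w - 1` times. -/
theorem card_connected_degree_eq_card_words (m : ℕ) {V : Type*} [Fintype V] (d : V → ℕ)
    (hV : Fintype.card V = m + 2) (hd : ∑ w, d w = 2 * (m + 1)) :
    (Finset.univ.filter fun G : SimpleGraph V => G.Connected ∧ ∀ w, G.degree w = d w).card =
      (Finset.univ.filter fun f : Fin m → V => ∀ w, 1 + letterCount f w = d w).card := by
  have : Nontrivial V := Fintype.one_lt_card_iff_nontrivial.1 (by omega)
  by_cases hpos : ∀ w, 1 ≤ d w
  swap
  -- If `d` vanishes somewhere, both sets are empty.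
  · push Not at hpos
    obtain ⟨w, hw⟩ := hpos
    rw [Finset.card_eq_zero.2, Finset.card_eq_zero.2]
    · refine Finset.filter_eq_empty_iff.2 fun f _ h => ?_
      have := h w
      omega
    · refine Finset.filter_eq_empty_iff.2 fun G _ h => ?_
      have := h.1.preconnected.degree_pos_of_nontrivial w
      have := h.2 w
      omega
  cases m with
  | zero =>
    have h1 : ∀ w, d w = 1 := by
      have hsum : ∑ w : V, 1 = ∑ w, d w := by simp [hd, hV]
      intro w
      exact ((Finset.sum_eq_sum_iff_of_le fun i _ => hpos i).1 hsum w (Finset.mem_univ w)).symm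
    simp only [h1]
    rw [filter_connected_degree_eq_one hV]
    simp [letterCount]
  | succ m =>
    -- Otherwise all degrees are at least 2 and sum to at least `2 * (m + 3)`, more than `2 * (m +
    -- 2)`.
    obtain ⟨v, hv⟩ : ∃ v, d v = 1 := by
      by_contra! hne
      have : ∑ w : V, 2 ≤ ∑ w, d w := Finset.sum_le_sum fun w _ => by
        have := hpos w
        have := hne w
        omega
      simp only [Finset.sum_const, Finset.card_univ, hV, hd, smul_eq_mul] at this
      omega
    rw [card_connected_degree_eq_sum d v hv, card_letterCount_eq_sum m d v hv]
    refine Finset.sum_congr rfl fun u _ => ?_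
    have hV' : Fintype.card {w // w ≠ v} = m + 2 := by
      rw [Fintype.card_subtype_compl, hV, Fintype.card_subtype_eq]
      omega
    -- The truncated subtraction is exact because `d u ≥ 1`.
    let d' : {w // w ≠ v} → ℕ := fun w => d w - if w = u then 1 else 0
    have hd' (w : {w // w ≠ v}) : d' w + (if w = u then 1 else 0) = d w := by
      have := hpos w
      simp only [d']
      split_ifs <;> omega
    have hsum : ∑ w, d' w = 2 * (m + 1) := by
      have h1 : ∑ w, (d' w + if w = u then 1 else 0) = ∑ w : {w // w ≠ v}, d w :=
        Finset.sum_congr rfl fun w _ => hd' w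
      rw [Finset.sum_add_distrib, Finset.sum_ite_eq' Finset.univ u, if_pos (Finset.mem_univ u)] at h1
      rw [Fintype.sum_eq_add_sum_subtype_ne _ v] at hd
      omega
    simp only [← hd', add_left_inj]
    convert card_connected_degree_eq_card_words m d' hV' hsum

open Classical in
lemma IsTree.sum_degree {V : Type*} [Fintype V] {G : SimpleGraph V} (hG : G.IsTree) :
    ∑ v, G.degree v = 2 * (Fintype.card V - 1) := by
  rw [G.sum_degrees_eq_twice_card_edges]
  have := hG.card_edgeFinset
  omega

open Classical in
lemma Connected.isTree_of_sum_degree {V : Type*} [Fintype V] {G : SimpleGraph V}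
    (hG : G.Connected) (h : ∑ v, G.degree v = 2 * (Fintype.card V - 1)) : G.IsTree := by
  rw [isTree_iff_connected_and_card]
  refine ⟨hG, ?_⟩
  rw [G.sum_degrees_eq_twice_card_edges] at h
  have : 0 < Fintype.card V := Fintype.card_pos_iff.2 hG.nonempty
  rw [Nat.card_eq_fintype_card, Nat.card_eq_fintype_card, ← edgeFinset_card]
  omega

open Classical in
/-- The degree functions of the trees on `V`, with multiplicities, are the functions counting the
letters (plus one) of the words of length `card V - 2`. -/
theorem sum_isTree_degree {V : Type*} [Fintype V] [DecidableEq V] {m : ℕ} (hV : Fintype.card V = m + 2)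
    {M : Type*} [AddCommMonoid M] (Φ : (V → ℕ) → M) :
    ∑ G ∈ Finset.univ.filter (fun G : SimpleGraph V => G.IsTree), Φ (fun v => G.degree v) =
      ∑ f : Fin m → V, Φ (fun v => 1 + letterCount f v) := by
  -- Equality of multisets of degree functions allows any weight `Φ`; the rooted case needs one
  -- depending on the root.
  have key : (Finset.univ.filter (fun G : SimpleGraph V => G.IsTree)).val.map
        (fun G v => G.degree v) =
      (Finset.univ : Finset (Fin m → V)).val.map (fun f v => 1 + letterCount f v) := by
    ext d
    rw [Multiset.count_map, Multiset.count_map, ← Finset.filter_val, ← Finset.filter_val,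
      Finset.card_val, Finset.card_val, Finset.filter_filter]
    by_cases hd : ∑ w, d w = 2 * (m + 1)
    · convert card_connected_degree_eq_card_words m d hV hd using 2
      · ext G
        simp only [Finset.mem_filter, Finset.mem_univ, true_and, funext_iff, eq_comm (a := d _)]
        refine ⟨fun h => ⟨h.1.connected, h.2⟩, fun h => ⟨h.1.isTree_of_sum_degree ?_, h.2⟩⟩
        simp only [h.2, hd, hV]
        rfl
      · ext f
        simp only [Finset.mem_filter, Finset.mem_univ, true_and, funext_iff, eq_comm (a := d _)]
        refine forall_congr' fun w => ?_
        convert Iff.rfl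
    · rw [Finset.card_eq_zero.2, Finset.card_eq_zero.2]
      · refine Finset.filter_eq_empty_iff.2 fun f _ h => hd ?_
        rw [h, Finset.sum_add_distrib, sum_letterCount, Finset.sum_const, Finset.card_univ, hV]
        simp only [smul_eq_mul]
        omega
      · refine Finset.filter_eq_empty_iff.2 fun G _ h => hd ?_
        rw [h.2, h.1.sum_degree, hV]
        rfl
  have := congrArg (fun s => (s.map Φ).sum) key
  simpa only [Multiset.map_map, Finset.sum_eq_multiset_sum, Function.comp_def] using this

/-- A neighbour nearer to `r` is the second vertex of a geodesic to `r`, and paths in a tree are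
unique. -/
lemma IsTree.existsUnique_adj_dist_lt {V : Type*} {G : SimpleGraph V} (hG : G.IsTree) {r v : V}
    (h : v ≠ r) : ∃! w, G.Adj v w ∧ G.dist w r < G.dist v r := by
  obtain ⟨p, hp⟩ := hG.connected.exists_walk_length_eq_dist v r
  have key (w : V) (hvw : G.Adj v w) (hw : G.dist w r < G.dist v r) :
      ∃ q : G.Walk v r, q.IsPath ∧ q.snd = w := by
    obtain ⟨q, hq⟩ := hG.connected.exists_walk_length_eq_dist w r
    refine ⟨q.cons hvw, Walk.isPath_of_length_eq_dist _ ?_, by simp⟩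
    have := dist_le (q.cons hvw)
    rw [Walk.length_cons] at this ⊢
    omega
  cases p with
  | nil => exact absurd rfl h
  | cons hvw q =>
    rename_i w
    rw [Walk.length_cons] at hp
    refine ⟨w, ⟨hvw, by have := dist_le q; omega⟩, ?_⟩
    rintro w' ⟨hvw', hw'⟩
    obtain ⟨q₁, hq₁, rfl⟩ := key w' hvw' hw'
    obtain ⟨q₂, hq₂, hw⟩ := key w hvw (by have := dist_le q; omega)
    rw [← hw, (hG.existsUnique_path v r).unique hq₁ hq₂]

-- Adjacent vertices of a tree are never equidistant from `r`, so the neighbours of `v` split into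
-- farther ones and nearer ones; there is one nearer neighbour unless `v = r`.
open Classical in
lemma IsTree.degree_eq_rootedInDegree_add {V : Type*} [Fintype V] {G : SimpleGraph V}
    (hG : G.IsTree) (r v : V) :
    G.degree v = rootedInDegree G r v + if r = v then 0 else 1 := by
  have h1 : rootedInDegree G r v =
      (Finset.univ.filter fun w => G.Adj v w ∧ ¬ G.dist w r < G.dist v r).card := by
    rw [rootedInDegree, Set.ncard_eq_toFinset_card']
    congr 1
    ext w
    simp only [Set.mem_toFinset, Set.mem_ofPred_eq, Finset.mem_filter, Finset.mem_univ, true_and,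
      G.adj_comm w v, not_lt]
    refine and_congr_right fun h => ⟨le_of_lt, fun h' => lt_of_le_of_ne h' ?_⟩
    rw [dist_comm, dist_comm (u := w)]
    exact hG.dist_ne_of_adj r h
  have h2 : (Finset.univ.filter fun w => G.Adj v w ∧ G.dist w r < G.dist v r).card =
      if r = v then 0 else 1 := by
    split_ifs with h
    · subst h
      simp
    · obtain ⟨w, hw, huniq⟩ := hG.existsUnique_adj_dist_lt (Ne.symm h)
      rw [Finset.card_eq_one]
      refine ⟨w, ?_⟩
      ext w'
      simp only [Finset.mem_filter, Finset.mem_univ, true_and, Finset.mem_singleton]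
      exact ⟨huniq w', fun h => h ▸ hw⟩
  rw [h1, ← h2, ← card_neighborFinset_eq_degree, neighborFinset_eq_filter, add_comm,
    ← Finset.filter_filter, ← Finset.filter_filter, Finset.card_filter_add_card_filter_not]

end SimpleGraph

/-! ### The operators and the tree polynomials -/

section

variable {R : Type*} [CommRing R]

lemma fullDartOp_prod_X {V : Type*} [Fintype V] [DecidableEq V] (a : V → ℕ) :
    fullDartOp R (∏ v, X (a v)) = ∑ u, ∏ v, X (a v + if u = v then 1 else 0) := by
  have h (s : Finset V) : fullDartOp R (∏ v ∈ s, X (a v)) =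
      ∑ u ∈ s, ∏ v ∈ s, X (a v + if u = v then 1 else 0) := by
    induction s using Finset.induction_on with
    | empty => simp
    | insert w s hw ih =>
      rw [Finset.prod_insert hw, Derivation.leibniz, ih, Finset.sum_insert hw,
        Finset.prod_insert hw, fullDartOp, mkDerivation_X, if_pos rfl, smul_eq_mul, smul_eq_mul,
        add_comm, Finset.mul_sum, mul_comm (X (a w + 1))]
      congr 1
      · congr 1
        refine Finset.prod_congr rfl fun v hv => ?_
        rw [if_neg (by rintro rfl; exact hw hv), add_zero]
      · refine Finset.sum_congr rfl fun u hu => ?_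
        rw [Finset.prod_insert hw, if_neg (by rintro rfl; exact hw hu), add_zero]
  exact h Finset.univ

lemma fullDartOp_iterate_prod_X {V : Type*} [Fintype V] [DecidableEq V] (a : V → ℕ) (k : ℕ) :
    (fullDartOp R)^[k] (∏ v, X (a v)) =
      ∑ f : Fin k → V, ∏ v, X (a v + letterCount f v) := by
  induction k with
  | zero => simp [letterCount]
  | succ k ih =>
    rw [Function.iterate_succ_apply', ih, map_sum, Finset.sum_congr rfl fun f _ =>
      fullDartOp_prod_X fun v => a v + letterCount f v, Finset.sum_comm,
      -- The newest letter is prepended; only letter counts matter, so order is irrelevant.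
      ← Fintype.sum_prod_type', ← (Fin.consEquiv fun _ : Fin (k + 1) => V).sum_comp]
    refine Finset.sum_congr rfl fun p _ => Finset.prod_congr rfl fun v _ => ?_
    change _ = X (a v + letterCount (Fin.cons p.1 p.2 : Fin (k + 1) → V) v)
    rw [letterCount_cons, add_assoc, add_comm (letterCount p.2 v)]

/-- The operator `dartOp R n` as a derivation. -/
noncomputable def dartDerivation (R : Type*) [CommRing R] (n : ℕ) :
    Derivation R (MvPolynomial ℕ R) (MvPolynomial ℕ R) :=
  ∑ j ∈ Finset.range n, (X (j + 1) : MvPolynomial ℕ R) • pderiv j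

lemma dartOp_eq_dartDerivation (n : ℕ) (p : MvPolynomial ℕ R) :
    dartOp R n p = dartDerivation R n p := by
  have h : (dartDerivation R n : MvPolynomial ℕ R → MvPolynomial ℕ R) =
      ∑ j ∈ Finset.range n, ⇑((X (j + 1) : MvPolynomial ℕ R) • pderiv j) :=
    map_sum Derivation.coeFnAddMonoidHom _ _
  simp [dartOp, h]

lemma dartOp_eq_fullDartOp {n : ℕ} {p : MvPolynomial ℕ R} (hp : p ∈ supported R (Set.Iio n)) :
    dartOp R n p = fullDartOp R p := by
  rw [dartOp_eq_dartDerivation]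
  refine derivation_eqOn_supported (fun j hj => ?_) hp
  have hj : j < n := hj
  simp [← dartOp_eq_dartDerivation, dartOp, fullDartOp, mkDerivation_X, pderiv_X,
    Pi.single_apply, hj]

lemma letterCount_le {V : Type*} [DecidableEq V] {m : ℕ} (f : Fin m → V) (v : V) :
    letterCount f v ≤ m := by
  refine (Finset.sum_le_card_nsmul _ _ 1 fun i _ => ?_).trans (by simp)
  split_ifs <;> simp

/-- After `k` steps all indices are at most `k`, so truncating `𝒟` at `k + 1` loses nothing. -/
lemma deltaOp_X_zero_pow (n k : ℕ) :
    deltaOp R k (X 0 ^ n) = (fullDartOp R)^[k] (X 0 ^ n) := by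
  induction k with
  | zero => rfl
  | succ k ih =>
    rw [Function.iterate_succ_apply', deltaOp, LinearMap.comp_apply, ih]
    refine dartOp_eq_fullDartOp ?_
    have h := fullDartOp_iterate_prod_X (R := R) (fun _ : Fin n => 0) k
    rw [Finset.prod_const, Finset.card_univ, Fintype.card_fin] at h
    rw [h]
    refine Subalgebra.sum_mem _ fun f _ => Subalgebra.prod_mem _ fun v _ => ?_
    rw [zero_add]
    exact Algebra.subset_adjoin ⟨_, Nat.lt_succ_of_le (letterCount_le f v), rfl⟩

lemma shiftVars_fullDartOp_iterate_X_zero_pow (n k : ℕ) :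
    shiftVars R ((fullDartOp R)^[k] (X 0 ^ n)) = (fullDartOp R)^[k] (X 1 ^ n) := by
  have h0 := fullDartOp_iterate_prod_X (R := R) (fun _ : Fin n => 0) k
  have h1 := fullDartOp_iterate_prod_X (R := R) (fun _ : Fin n => 1) k
  rw [Finset.prod_const, Finset.card_univ, Fintype.card_fin] at h0 h1
  rw [h0, h1]
  simp only [map_sum, map_prod, shiftVars, rename_X, Nat.succ_eq_add_one, add_comm]

lemma treePoly_eq {m : ℕ} :
    treePoly R (m + 2) = (fullDartOp R)^[m] (X 1 ^ (m + 2)) := by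
  have h1 := fullDartOp_iterate_prod_X (R := R) (fun _ : Fin (m + 2) => 1) m
  rw [Finset.prod_const, Finset.card_univ, Fintype.card_fin] at h1
  rw [h1, treePoly]
  exact SimpleGraph.sum_isTree_degree (V := Fin (m + 2)) (m := m) (Fintype.card_fin _)
    (fun d => ∏ v, (X (d v) : MvPolynomial ℕ R))

lemma rootedTreePoly_one : rootedTreePoly R 1 = X 0 := by
  classical
  have h (G : SimpleGraph (Fin 1)) (r : Fin 1) : rootedInDegree G r 0 = 0 := by
    rw [rootedInDegree, Set.ncard_eq_zero]
    ext w
    simp [Subsingleton.elim w 0]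
  have hT (G : SimpleGraph (Fin 1)) : G.IsTree := SimpleGraph.IsTree.of_subsingleton
  rw [rootedTreePoly, Finset.filter_true_of_mem fun T _ => hT T.1, Fintype.sum_subsingleton _ (⊥, 0)]
  simp [h]

lemma rootedTreePoly_eq {m : ℕ} :
    rootedTreePoly R (m + 2) = (fullDartOp R)^[m + 1] (X 0 ^ (m + 2)) := by
  classical
  have h0 := fullDartOp_iterate_prod_X (R := R) (fun _ : Fin (m + 2) => 0) (m + 1)
  rw [Finset.prod_const, Finset.card_univ, Fintype.card_fin] at h0
  -- The first letter of the word plays the root.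
  rw [h0, rootedTreePoly, ← (Fin.consEquiv fun _ : Fin (m + 1) => Fin (m + 2)).sum_comp,
    Fintype.sum_prod_type, Finset.sum_filter, Fintype.sum_prod_type_right]
  refine Finset.sum_congr rfl fun r _ => ?_
  have h := SimpleGraph.sum_isTree_degree (V := Fin (m + 2)) (m := m) (Fintype.card_fin _)
    (fun d => ∏ v, (X (d v - if r = v then 0 else 1) : MvPolynomial ℕ R))
  trans ∑ f : Fin m → Fin (m + 2),
    ∏ v, (X (1 + letterCount f v - if r = v then 0 else 1) : MvPolynomial ℕ R)
  · rw [← Finset.sum_filter]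
    refine Eq.trans (Finset.sum_congr rfl fun G hG => Finset.prod_congr rfl fun v _ => ?_) h
    have hG' : G.IsTree := (Finset.mem_filter.1 hG).2
    dsimp only
    rw [hG'.degree_eq_rootedInDegree_add r v]
    split_ifs <;> rfl
  · refine Finset.sum_congr rfl fun f _ => Finset.prod_congr rfl fun v _ => ?_
    change _ = X (0 + letterCount (Fin.cons r f : Fin (m + 1) → Fin (m + 2)) v)
    rw [letterCount_cons]
    split_ifs <;> simp

end

theorem mainTheorem3 (R : Type*) [CommRing R] (n : ℕ) :
    (1 ≤ n → rootedTreePoly R n = deltaOp R (n - 1) (X 0 ^ n)) ∧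
    (2 ≤ n →
      treePoly R n = shiftVars R (deltaOp R (n - 2) (X 0 ^ n)) ∧
      treePoly R n = (fullDartOp R)^[n - 2] (X 1 ^ n)) := by
  refine ⟨fun hn => ?_, fun hn => ?_⟩
  · obtain rfl | ⟨m, rfl⟩ : n = 1 ∨ ∃ m, n = m + 2 := by
      rcases n with _ | _ | m
      · omega
      · exact Or.inl rfl
      · exact Or.inr ⟨m, rfl⟩
    · rw [rootedTreePoly_one]
      simp [deltaOp]
    · rw [rootedTreePoly_eq, deltaOp_X_zero_pow]
      rfl
  · obtain ⟨m, rfl⟩ := Nat.exists_eq_add_of_le' hn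
    rw [Nat.add_sub_cancel, deltaOp_X_zero_pow, shiftVars_fullDartOp_iterate_X_zero_pow,
      treePoly_eq]
    exact ⟨rfl, rfl⟩
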